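/- **Definitions.** Let $k\in\mathbb N$. A *topological $k$-graph* is a small category $\Lambda$ with range (codomain) and source (domain) maps $r,s$ and a functor $d:\Lambda\to\mathbb N^k$ such that: the object and morphism sets are second-countable locally compact Hausdorff spaces; $r$ and $s$ are continuous and $s$ is a local homeomorphism; composition $(\lambda,\mu)\mapsto\lambda\mu$ (for $s(\lambda)=r(\mu)$) is continuous and open; $d$ is continuous for the discrete topology on $\mathbb N^k$; and whenever $d(\lambda)=m+n$ there is a unique composable pair $(\xi,\eta)$ with $\lambda=\xi\eta$, $d(\xi)=m$, $d(\eta)=n$. Put $\Lambda^m=d^{-1}(m)$. $\Lambda$ is *compactly aligned* if for all $p,q\in\mathbb N^k$ and compact $U\subset\Lambda^p$, $V\subset\Lambda^q$ the set $U\Lambda^{(p\vee q)-p}\cap V\Lambda^{(p\vee q)-q}$ is compact. For $m\in(\mathbb N\cup\{\infty\})^k$ let $\Omega_{k,m}$ be the (discrete) category with objects $p\in\mathbb N^k$, $p\le m$, and morphisms $(p,q)$, $p\le q\le m$, with range $p$, source $q$ and degree $q-p$. The path space $X_\Lambda$ is the set of all degree-preserving functors $x:\Omega_{k,m}\to\Lambda$,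 $m=:d(x)\in(\mathbb N\cup\{\infty\})^k$; write $r(x)=x(0)$. For $s(\lambda)=r(x)$, $\lambda x$ denotes the concatenated path. The *path groupoid* $G_\Lambda$ has unit set $X_\Lambda$ and morphisms the triples $(\lambda x,d(\lambda)-d(\mu),\mu x)\in X_\Lambda\times\mathbb Z^k\times X_\Lambda$ with $\lambda,\mu\in\Lambda$, $x\in X_\Lambda$, $s(\lambda)=s(\mu)=r(x)$; $r(x,m,y)=x$, $s(x,m,y)=y$, $(x,m,y)(y,n,z)=(x,m+n,z)$, $(x,m,y)^{-1}=(y,-m,x)$. For a set $F$ of pairs $(\lambda,\mu)$ with $s(\lambda)=s(\mu)$, let $Z(F,m)$ be the set of the triples $(\lambda x,d(\lambda)-d(\mu),\mu x)$ with $(\lambda,\mu)\in F$ and $d(\lambda)-d(\mu)=m$. The topology of $G_\Lambda$ is generated by the sets $Z(\{(\lambda,\mu)\in U\times V: s(\lambda)=s(\mu)\},m)\setminus Z(F,m)$ with $m\in\mathbb Z^k$, $U,V\subset\Lambda$ open and $F$ compact. For a vertex $v$, let $v\mathcal{CE}(\Lambda)$ be the set of compact $E\subset\Lambda$ such that $r(E)$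 is a neighbourhood of $v$ and for every $\lambda\in\Lambda$ with $r(\lambda)\in r(E)$ there are $\mu\in E$ and $\alpha,\beta\in\Lambda$ with $\lambda\alpha=\mu\beta$ and $d(\lambda\alpha)=d(\lambda)\vee d(\mu)$. The set $\partial\Lambda$ of boundary paths consists of those $x\in X_\Lambda$ such that for all $m\in\mathbb N^k$ with $m\le d(x)$ and all $E\in x(m)\mathcal{CE}(\Lambda)$ there is $\lambda\in E$ with $m+d(\lambda)\le d(x)$ and $x(m,m+d(\lambda))=\lambda$. The *boundary-path groupoid* $\mathcal G_\Lambda$ is the reduction $G_\Lambda|_{\partial\Lambda}$. Let $A$ be a locally compact (Hausdorff) group and $c:\Lambda\to A$ a continuous functor. The *skew product* $\Lambda\times_cA$ has object space $\mathrm{Obj}(\Lambda)\times A$ and morphism space $\Lambda\times A$ (product topologies), $r(\lambda,a)=(r(\lambda),a)$, $s(\lambda,a)=(s(\lambda),ac(\lambda))$, $(\lambda,a)(\mu,ac(\lambda))=(\lambda\mu,a)$ and $d(\lambda,a)=d(\lambda)$. (It is a topological $k$-graph, except that it need not be second countable when $A$ is not; $G$, $\partial$ and $\mathcal G$ are defined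 for it as above.) The functor $c$ induces a continuous functor $\tilde c:G_\Lambda\to A$, $\tilde c(\lambda x,d(\lambda)-d(\mu),\mu x)=c(\lambda)c(\mu)^{-1}$. For a groupoid $\Gamma$ with a topology and a continuous functor $b:\Gamma\to A$, the skew product $\Gamma(b)$ is $\Gamma\times A$ with the product topology, $(\gamma,g)(\gamma',g\,b(\gamma))=(\gamma\gamma',g)$ and $(\gamma,g)^{-1}=(\gamma^{-1},g\,b(\gamma))$. **Proposition.** Let $\Lambda$ be a compactly aligned topological $k$-graph, let $A$ be a locally compact group and let $c:\Lambda\to A$ be a continuous functor. Then, as topological groupoids (that is, by a groupoid isomorphism which is a homeomorphism), $$G_\Lambda(\tilde c)\cong G_{\Lambda\times_cA}.$$ Furthermore, denoting the restriction of $\tilde c$ to $\mathcal G_\Lambda=G_\Lambda|_{\partial\Lambda}$ again by $\tilde c$, $$\mathcal G_\Lambda(\tilde c)\cong\mathcal G_{\Lambda\times_cA}.$$ -/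

import Mathlib

universe u v w

namespace HRGraph

open Topology

/-! ## Small categories with a space of morphisms -/

/-- A small category given by its set of objects, its set of morphisms, range (codomain) and
source (domain) maps, identities, and the composition `f g` of those pairs `(f, g)` with
`s f = r g`.  The set of morphisms carries a topology. -/
structure ArrCat where
  Obj : Type u
  Mor : Type v
  [topMor : TopologicalSpace Mor]
  r : Mor → Obj
  s : Mor → Obj
  one : Obj → Mor
  comp : (f g : Mor) → s f = r g → Mor
  r_one : ∀ a, r (one a) = a
  s_one : ∀ a, s (one a) = a
  r_comp : ∀ f g h, r (comp f g h) = r f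
  s_comp : ∀ f g h, s (comp f g h) = s g
  one_comp : ∀ f, comp (one (r f)) f (s_one _) = f
  comp_one : ∀ f, comp f (one (s f)) (r_one _).symm = f
  assoc : ∀ (f g k : Mor) (h : s f = r g) (h' : s g = r k),
    comp (comp f g h) k ((s_comp f g h).trans h')
      = comp f (comp g k h') (h.trans (r_comp g k h').symm)

attribute [instance] ArrCat.topMor

/-- A continuous functor from a category to a topological group (viewed as a category with one
object). -/
structure ContFunctor (C : ArrCat.{u, v}) (A : Type w) [Group A] [TopologicalSpace A] where
  toFun : C.Mor → A
  map_one : ∀ a, toFun (C.one a) = 1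
  map_comp : ∀ f g h, toFun (C.comp f g h) = toFun f * toFun g
  continuous_toFun : Continuous toFun

/-- The skew product of a category by a functor `c` into a group `A`: objects `Obj × A`,
morphisms `Mor × A` (product topology), `r (f, a) = (r f, a)`, `s (f, a) = (s f, a c(f))` and
`(f, a) (g, a c(f)) = (f g, a)`. -/
def ArrCat.skew (C : ArrCat.{u, v}) {A : Type w} [Group A] [TopologicalSpace A]
    (c : ContFunctor C A) : ArrCat.{max u w, max v w} where
  Obj := C.Obj × A
  Mor := C.Mor × A
  r f := (C.r f.1, f.2)
  s f := (C.s f.1, f.2 * c.toFun f.1)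
  one a := (C.one a.1, a.2)
  comp f g h := (C.comp f.1 g.1 (congrArg Prod.fst h), f.2)
  r_one a := by simp [C.r_one]
  s_one a := by simp [C.s_one, c.map_one]
  r_comp f g h := by simp [C.r_comp]
  s_comp f g h := by
    have h2 : f.2 * c.toFun f.1 = g.2 := congrArg Prod.snd h
    simp [C.s_comp, c.map_comp, ← h2, mul_assoc]
  one_comp f := by simp [C.one_comp]
  comp_one f := by simp [C.comp_one]
  assoc f g k h h' := Prod.ext (C.assoc _ _ _ _ _) rfl

/-! ## Groupoids -/

/-- A groupoid whose set of morphisms carries a topology.  As usual, the space of objects (units)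
is topologised as the subspace of identity morphisms.  (Continuity of the operations is not needed
to say what an isomorphism of topological groupoids is.) -/
structure TopGroupoid extends ArrCat.{u, v} where
  inv : Mor → Mor
  r_inv : ∀ f, r (inv f) = s f
  s_inv : ∀ f, s (inv f) = r f
  inv_comp : ∀ f, comp (inv f) f (s_inv f) = one (s f)
  comp_inv : ∀ f, comp f (inv f) (r_inv f).symm = one (r f)

namespace TopGroupoid

instance (G : TopGroupoid.{u, v}) : TopologicalSpace G.Obj :=
  TopologicalSpace.induced G.one inferInstance

/-- An isomorphism of topological groupoids: an isomorphism of categories which is a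
homeomorphism on morphisms and on units. -/
structure Iso (G : TopGroupoid.{u, v}) (H : TopGroupoid.{u, v}) where
  obj : G.Obj ≃ₜ H.Obj
  mor : G.Mor ≃ₜ H.Mor
  map_r : ∀ f, H.r (mor f) = obj (G.r f)
  map_s : ∀ f, H.s (mor f) = obj (G.s f)
  map_one : ∀ a, mor (G.one a) = H.one (obj a)
  map_comp : ∀ (f g : G.Mor) (h : G.s f = G.r g),
    mor (G.comp f g h)
      = H.comp (mor f) (mor g) ((map_s f).trans ((congrArg obj h).trans (map_r g).symm))

/-- The skew-product groupoid `G(b)`; the inverse is `(x, g)⁻¹ = (x⁻¹, g b(x))`. -/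
def skew (G : TopGroupoid.{u, v}) {A : Type w} [Group A] [TopologicalSpace A]
    (b : ContFunctor G.toArrCat A) : TopGroupoid.{max u w, max v w} where
  toArrCat := G.toArrCat.skew b
  inv f := (G.inv f.1, f.2 * b.toFun f.1)
  r_inv f := by simp [ArrCat.skew, G.r_inv]
  s_inv f := by
    have h : b.toFun f.1 * b.toFun (G.inv f.1) = 1 := by
      rw [← b.map_comp f.1 (G.inv f.1) (G.r_inv _).symm, G.comp_inv, b.map_one]
    simp [ArrCat.skew, G.s_inv, mul_assoc, h]
  inv_comp f := by simp [ArrCat.skew, G.inv_comp]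
  comp_inv f := by simp [ArrCat.skew, G.comp_inv]

/-- The reduction `G|_Y` of a groupoid to a set `Y` of units. -/
def reduction (G : TopGroupoid.{u, v}) (Y : Set G.Obj) : TopGroupoid.{u, v} where
  Obj := Y
  Mor := {f : G.Mor // G.r f ∈ Y ∧ G.s f ∈ Y}
  r f := ⟨G.r f.1, f.2.1⟩
  s f := ⟨G.s f.1, f.2.2⟩
  one a := ⟨G.one a.1, by rw [G.r_one]; exact a.2, by rw [G.s_one]; exact a.2⟩
  comp f g h := ⟨G.comp f.1 g.1 (congrArg Subtype.val h),
    by rw [G.r_comp]; exact f.2.1, by rw [G.s_comp]; exact g.2.2⟩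
  r_one a := Subtype.ext (G.r_one _)
  s_one a := Subtype.ext (G.s_one _)
  r_comp f g h := Subtype.ext (G.r_comp _ _ _)
  s_comp f g h := Subtype.ext (G.s_comp _ _ _)
  one_comp f := Subtype.ext (G.one_comp _)
  comp_one f := Subtype.ext (G.comp_one _)
  assoc f g k h h' := Subtype.ext (G.assoc _ _ _ _ _)
  inv f := ⟨G.inv f.1, by rw [G.r_inv]; exact f.2.2, by rw [G.s_inv]; exact f.2.1⟩
  r_inv f := Subtype.ext (G.r_inv _)
  s_inv f := Subtype.ext (G.s_inv _)
  inv_comp f := Subtype.ext (G.inv_comp _)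
  comp_inv f := Subtype.ext (G.comp_inv _)

/-- The restriction of a continuous functor to a reduction. -/
def restrict {G : TopGroupoid.{u, v}} {A : Type w} [Group A] [TopologicalSpace A]
    (b : ContFunctor G.toArrCat A) (Y : Set G.Obj) :
    ContFunctor (G.reduction Y).toArrCat A where
  toFun f := b.toFun f.1
  map_one a := b.map_one _
  map_comp f g h := b.map_comp _ _ _
  continuous_toFun := b.continuous_toFun.comp continuous_subtype_val

end TopGroupoid

/-! ## Topological higher-rank graphs -/

/-- A topological `k`-graph, except that second countability of the two spaces is not part of the
structure and is imposed separately where it is wanted: all the other conditions are inherited by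
the skew product by an arbitrary locally compact group. -/
structure TopKGraph (k : ℕ) extends ArrCat.{u, v} where
  [topObj : TopologicalSpace Obj]
  [t2Obj : T2Space Obj]
  [t2Mor : T2Space Mor]
  [lcObj : LocallyCompactSpace Obj]
  [lcMor : LocallyCompactSpace Mor]
  continuous_r : Continuous r
  isLocalHomeomorph_s : IsLocalHomeomorph s
  continuous_comp :
    Continuous fun p : {p : Mor × Mor // s p.1 = r p.2} => comp p.1.1 p.1.2 p.2
  isOpenMap_comp :
    IsOpenMap fun p : {p : Mor × Mor // s p.1 = r p.2} => comp p.1.1 p.1.2 p.2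
  /-- The degree map. -/
  deg : Mor → (Fin k → ℕ)
  deg_one : ∀ a, deg (one a) = 0
  deg_comp : ∀ f g h, deg (comp f g h) = deg f + deg g
  continuous_deg : Continuous deg
  factorization : ∀ (f : Mor) (m n : Fin k → ℕ), deg f = m + n →
    ∃! p : Mor × Mor, ∃ h : s p.1 = r p.2, comp p.1 p.2 h = f ∧ deg p.1 = m ∧ deg p.2 = n

attribute [instance] TopKGraph.topObj TopKGraph.t2Obj TopKGraph.t2Mor TopKGraph.lcObj
  TopKGraph.lcMor

/-- A product of a local homeomorphism with the identity is a local homeomorphism. -/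
theorem isLocalHomeomorph_prod_id {X Y Z : Type*} [TopologicalSpace X] [TopologicalSpace Y]
    [TopologicalSpace Z] {f : X → Y} (hf : IsLocalHomeomorph f) :
    IsLocalHomeomorph (fun p : X × Z => (f p.1, p.2)) := by
  intro p
  obtain ⟨e, he, hfe⟩ := hf p.1
  exact ⟨e.prod (OpenPartialHomeomorph.refl Z), ⟨he, trivial⟩, by funext q; simp [hfe]⟩

namespace TopKGraph

variable {k : ℕ}

/-- The skew product `Λ ×_c A` of a topological `k`-graph, with degree map `d(f, a) = d(f)` and
the product topologies. -/
def skew (Λ : TopKGraph.{u, v} k) {A : Type w} [Group A] [TopologicalSpace A]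
    [IsTopologicalGroup A] [LocallyCompactSpace A] [T2Space A]
    (c : ContFunctor Λ.toArrCat A) : TopKGraph.{max u w, max v w} k where
  toArrCat := Λ.toArrCat.skew c
  topObj := (instTopologicalSpaceProd : TopologicalSpace (Λ.Obj × A))
  t2Obj := (Prod.t2Space : T2Space (Λ.Obj × A))
  t2Mor := (Prod.t2Space : T2Space (Λ.Mor × A))
  lcObj := (Prod.locallyCompactSpace Λ.Obj A : LocallyCompactSpace (Λ.Obj × A))
  lcMor := (Prod.locallyCompactSpace Λ.Mor A : LocallyCompactSpace (Λ.Mor × A))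
  continuous_r := by
    change Continuous fun f : Λ.Mor × A => (Λ.r f.1, f.2)
    have := Λ.continuous_r
    fun_prop
  isLocalHomeomorph_s := by
    change IsLocalHomeomorph fun f : Λ.Mor × A => (Λ.s f.1, f.2 * c.toFun f.1)
    have hc := c.continuous_toFun
    let e : (Λ.Mor × A) ≃ₜ (Λ.Mor × A) :=
      { toFun := fun f => (f.1, f.2 * c.toFun f.1)
        invFun := fun f => (f.1, f.2 * (c.toFun f.1)⁻¹)
        left_inv := fun f => by simp
        right_inv := fun f => by simp
        continuous_toFun := by fun_prop
        continuous_invFun := by fun_prop }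
    exact (isLocalHomeomorph_prod_id (Z := A) Λ.isLocalHomeomorph_s).comp e.isLocalHomeomorph
  continuous_comp := by
    change Continuous fun p : {p : (Λ.Mor × A) × (Λ.Mor × A) //
      (Λ.s p.1.1, p.1.2 * c.toFun p.1.1) = (Λ.r p.2.1, p.2.2)} =>
        (Λ.comp p.1.1.1 p.1.2.1 (congrArg Prod.fst p.2), p.1.1.2)
    refine Continuous.prodMk ?_ (by fun_prop)
    exact Λ.continuous_comp.comp
      (f := fun p : {p : (Λ.Mor × A) × (Λ.Mor × A) //
        (Λ.s p.1.1, p.1.2 * c.toFun p.1.1) = (Λ.r p.2.1, p.2.2)} =>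
        (⟨(p.1.1.1, p.1.2.1), congrArg Prod.fst p.2⟩ :
          {p : Λ.Mor × Λ.Mor // Λ.s p.1 = Λ.r p.2}))
      (Continuous.subtype_mk (by fun_prop) _)
  isOpenMap_comp := by
    change IsOpenMap fun p : {p : (Λ.Mor × A) × (Λ.Mor × A) //
      (Λ.s p.1.1, p.1.2 * c.toFun p.1.1) = (Λ.r p.2.1, p.2.2)} =>
        (Λ.comp p.1.1.1 p.1.2.1 (congrArg Prod.fst p.2), p.1.1.2)
    have hc := c.continuous_toFun
    let e : {p : (Λ.Mor × A) × (Λ.Mor × A) //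
        (Λ.s p.1.1, p.1.2 * c.toFun p.1.1) = (Λ.r p.2.1, p.2.2)} ≃ₜ
        {p : Λ.Mor × Λ.Mor // Λ.s p.1 = Λ.r p.2} × A :=
      { toFun := fun p => (⟨(p.1.1.1, p.1.2.1), congrArg Prod.fst p.2⟩, p.1.1.2)
        invFun := fun q => ⟨((q.1.1.1, q.2), (q.1.1.2, q.2 * c.toFun q.1.1.1)),
          by simp [q.1.2]⟩
        left_inv := fun p => by
          obtain ⟨⟨⟨f, a⟩, ⟨g, b⟩⟩, h⟩ := p
          have h2 : a * c.toFun f = b := congrArg Prod.snd h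
          subst h2
          rfl
        right_inv := fun q => rfl
        continuous_toFun := by
          refine Continuous.prodMk (Continuous.subtype_mk (by fun_prop) _) (by fun_prop)
        continuous_invFun := by
          refine Continuous.subtype_mk (by fun_prop) _ }
    exact (Λ.isOpenMap_comp.prodMap (IsOpenMap.id (X := A))).comp e.isOpenMap
  deg f := Λ.deg f.1
  deg_one a := Λ.deg_one _
  deg_comp f g h := Λ.deg_comp _ _ _
  continuous_deg := Λ.continuous_deg.comp continuous_fst
  factorization := by
    rintro ⟨f, a⟩ m n hf
    obtain ⟨⟨g, g'⟩, ⟨h, hc, hm, hn⟩, huniq⟩ := Λ.factorization f m n hf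
    refine ⟨((g, a), (g', a * c.toFun g)), ⟨Prod.ext h rfl, Prod.ext hc rfl, hm, hn⟩, ?_⟩
    rintro ⟨⟨x, b⟩, ⟨y, b'⟩⟩ ⟨hxy, hcomp, hx, hy⟩
    have h1 : Λ.s x = Λ.r y := congrArg Prod.fst hxy
    have h2 : b * c.toFun x = b' := congrArg Prod.snd hxy
    have h3 : Λ.comp x y h1 = f := congrArg Prod.fst hcomp
    have h4 : b = a := congrArg Prod.snd hcomp
    have h5 := huniq (x, y) ⟨h1, h3, hx, hy⟩
    obtain ⟨rfl, rfl⟩ := Prod.mk.inj h5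
    subst h4
    subst h2
    rfl

section Aligned

variable (Λ : TopKGraph.{u, v} k)

/-- The set `U W` of all compositions of paths of `U` with paths of `W`. -/
def prodSet (U W : Set Λ.Mor) : Set Λ.Mor :=
  {f | ∃ g ∈ U, ∃ g' ∈ W, ∃ h : Λ.s g = Λ.r g', Λ.comp g g' h = f}

/-- The paths of degree `m`. -/
def degSet (m : Fin k → ℕ) : Set Λ.Mor := {f | Λ.deg f = m}

/-- `U ∨ V`, the minimal common extensions of paths from `U ⊆ Λ^p` and `V ⊆ Λ^q`. -/
def minExtSet (p q : Fin k → ℕ) (U V : Set Λ.Mor) : Set Λ.Mor :=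
  Λ.prodSet U (Λ.degSet (p ⊔ q - p)) ∩ Λ.prodSet V (Λ.degSet (p ⊔ q - q))

/-- `Λ` is compactly aligned. -/
def CompactlyAligned : Prop :=
  ∀ (p q : Fin k → ℕ) (U V : Set Λ.Mor), U ⊆ Λ.degSet p → V ⊆ Λ.degSet q →
    IsCompact U → IsCompact V → IsCompact (Λ.minExtSet p q U V)

/-- `Λ^min(f, g)`. -/
def minExt (f g : Λ.Mor) : Set (Λ.Mor × Λ.Mor) :=
  {p | ∃ (h : Λ.s f = Λ.r p.1) (h' : Λ.s g = Λ.r p.2),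
    Λ.comp f p.1 h = Λ.comp g p.2 h' ∧ Λ.deg (Λ.comp f p.1 h) = Λ.deg f ⊔ Λ.deg g}

/-- `E` is exhaustive for the set `V` of vertices. -/
def Exhaustive (E : Set Λ.Mor) (V : Set Λ.Obj) : Prop :=
  (∀ g ∈ E, Λ.r g ∈ V) ∧ ∀ f, Λ.r f ∈ V → ∃ g ∈ E, (Λ.minExt f g).Nonempty

/-- `a 𝒞ℰ(Λ)`: the compact sets `E` of paths such that `r(E)` is a neighbourhood of the vertex
`a` and `E` is exhaustive for `r(E)`. -/
def CE (a : Λ.Obj) : Set (Set Λ.Mor) :=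
  {E | IsCompact E ∧ Λ.r '' E ∈ 𝓝 a ∧ Λ.Exhaustive E (Λ.r '' E)}

end Aligned

/-! ## The path space -/

/-- The inclusion of `ℕ^k` in `(ℕ ∪ {∞})^k`. -/
abbrev toENat (p : Fin k → ℕ) : Fin k → ℕ∞ := fun i => (p i : ℕ∞)

/-- An element `x` of the path space `X_Λ`: a degree-preserving functor `x : Ω_{k,m} → Λ`, where
`m = deg`.  The objects of `Ω_{k,m}` are the `p ∈ ℕ^k` with `p ≤ m`; its morphisms are the pairs
`(p, q)` with `p ≤ q ≤ m`, of range `p`, source `q` and degree `q - p`, with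
`(n, p) (p, q) = (n, q)`.  Since `Ω_{k,m}` is discrete, every such functor is continuous. -/
structure Path (Λ : TopKGraph.{u, v} k) where
  deg : Fin k → ℕ∞
  obj : ∀ p : Fin k → ℕ, toENat p ≤ deg → Λ.Obj
  map : ∀ p q : Fin k → ℕ, p ≤ q → toENat q ≤ deg → Λ.Mor
  r_map : ∀ p q hpq hq (hp : toENat p ≤ deg), Λ.r (map p q hpq hq) = obj p hp
  s_map : ∀ p q hpq hq, Λ.s (map p q hpq hq) = obj q hq
  map_self : ∀ p hp, map p p le_rfl hp = Λ.one (obj p hp)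
  map_comp : ∀ n p q (hnp : n ≤ p) (hpq : p ≤ q) (hp : toENat p ≤ deg) (hq : toENat q ≤ deg),
    map n q (hnp.trans hpq) hq
      = Λ.comp (map n p hnp hp) (map p q hpq hq) ((s_map n p hnp hp).trans (r_map p q hpq hq hp).symm)
  deg_map : ∀ p q hpq hq, Λ.deg (map p q hpq hq) = q - p

namespace Path

variable {Λ : TopKGraph.{u, v} k}

theorem ext' {x y : Λ.Path} (hd : x.deg = y.deg)
    (hm : ∀ p q hpq hx hy, x.map p q hpq hx = y.map p q hpq hy) : x = y := by
  obtain ⟨d, o, m, h1, h2, h3, h4, h5⟩ := x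
  obtain ⟨d', o', m', h1', h2', h3', h4', h5'⟩ := y
  obtain rfl : d = d' := hd
  have hmm : m = m' := by
    funext p q hpq hq
    exact hm p q hpq hq hq
  subst hmm
  have ho : o = o' := by
    funext p hp
    rw [← h2 p p le_rfl hp, ← h2' p p le_rfl hp]
  subst ho
  rfl

theorem le_add_iff {m q : Fin k → ℕ} {d : Fin k → ℕ∞} (h : toENat m ≤ d) :
    toENat q ≤ d - toENat m ↔ toENat (m + q) ≤ d := by
  have key : ∀ (a b : ℕ) (t : ℕ∞), (a : ℕ∞) ≤ t →
      ((b : ℕ∞) ≤ t - (a : ℕ∞) ↔ ((a + b : ℕ) : ℕ∞) ≤ t) := by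
    intro a b t hat
    induction t using ENat.recTopCoe with
    | top => simp
    | coe n => norm_cast at hat ⊢; omega
  exact ⟨fun hq i => (key _ _ _ (h i)).1 (hq i), fun hq i => (key _ _ _ (h i)).2 (hq i)⟩

/-- The shift `σ^m x`, of degree `d(x) - m`, given by `(σ^m x)(p, q) = x(m + p, m + q)`. -/
def shift (x : Λ.Path) (m : Fin k → ℕ) (h : toENat m ≤ x.deg) : Λ.Path where
  deg := x.deg - toENat m
  obj p hp := x.obj (m + p) ((le_add_iff h).1 hp)
  map p q hpq hq := x.map (m + p) (m + q) (add_le_add_right hpq m) ((le_add_iff h).1 hq)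
  r_map p q hpq hq hp := x.r_map _ _ _ _ _
  s_map p q hpq hq := x.s_map _ _ _ _
  map_self p hp := x.map_self _ _
  map_comp n p q hnp hpq hp hq := x.map_comp _ _ _ _ _ _ _
  deg_map p q hpq hq := by rw [x.deg_map]; exact add_tsub_add_eq_tsub_left m q p

/-- `z = f x`: the path `z` is the concatenation of the morphism `f` with the path `x`, i.e.
`z(0, d(f)) = f` and `σ^{d(f)} z = x`. -/
def IsConcat (z : Λ.Path) (f : Λ.Mor) (x : Λ.Path) : Prop :=
  ∃ h : toENat (Λ.deg f) ≤ z.deg, z.map 0 (Λ.deg f) zero_le h = f ∧ z.shift (Λ.deg f) h = x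

/-- `x` is a boundary path. -/
def IsBoundary (x : Λ.Path) : Prop :=
  ∀ (m : Fin k → ℕ) (hm : toENat m ≤ x.deg), ∀ E ∈ Λ.CE (x.obj m hm), ∃ f ∈ E,
    ∃ h : toENat (m + Λ.deg f) ≤ x.deg, x.map m (m + Λ.deg f) le_self_add h = f

theorem map_congr (x : Λ.Path) {p p' q q' : Fin k → ℕ} (h1 : p = p') (h2 : q = q') (hpq hq) :
    x.map p q hpq hq = x.map p' q' (h1 ▸ h2 ▸ hpq) (h2 ▸ hq) := by
  subst h1; subst h2; rfl

theorem shift_congr (x : Λ.Path) {m m' : Fin k → ℕ} (h : m = m') (hm) :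
    x.shift m hm = x.shift m' (h ▸ hm) := by
  subst h; rfl

theorem shift_shift (x : Λ.Path) (m n : Fin k → ℕ) (hm) (hn : toENat n ≤ (x.shift m hm).deg) :
    (x.shift m hm).shift n hn = x.shift (m + n) ((le_add_iff hm).1 hn) := by
  refine ext' ?_ ?_
  · funext i
    simp [shift, toENat, tsub_tsub]
  · intro p q hpq hx hy
    exact x.map_congr (add_assoc _ _ _).symm (add_assoc _ _ _).symm _ _

theorem isConcat_shift (x : Λ.Path) (p : Fin k → ℕ) (hp : toENat p ≤ x.deg) :
    x.IsConcat (x.map 0 p zero_le hp) (x.shift p hp) := by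
  have h : Λ.deg (x.map 0 p zero_le hp) = p := by rw [x.deg_map, tsub_zero]
  refine ⟨by rw [h]; exact hp, x.map_congr rfl h _ _, x.shift_congr h _⟩

/-- Extending the initial segment of a concatenation. -/
theorem IsConcat.extend {z x : Λ.Path} {f : Λ.Mor} (h : z.IsConcat f x) (a : Fin k → ℕ)
    (ha : toENat a ≤ x.deg) :
    ∃ g, Λ.deg g = Λ.deg f + a ∧ z.IsConcat g (x.shift a ha) ∧
      ∃ hs : Λ.s f = Λ.r (x.map 0 a zero_le ha),
        g = Λ.comp f (x.map 0 a zero_le ha) hs := by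
  obtain ⟨h1, h2, rfl⟩ := h
  have ha' := (le_add_iff h1).1 ha
  refine ⟨z.map 0 (Λ.deg f + a) zero_le ha', by rw [z.deg_map, tsub_zero], ?_, ?_⟩
  · rw [shift_shift]
    exact z.isConcat_shift _ _
  · have e : (z.shift (Λ.deg f) h1).map 0 a zero_le ha
        = z.map (Λ.deg f) (Λ.deg f + a) le_self_add ha' :=
      z.map_congr (add_zero _) rfl _ _
    have hs : Λ.s f = Λ.r ((z.shift (Λ.deg f) h1).map 0 a zero_le ha) := by
      rw [e, z.r_map _ _ _ _ h1]
      conv_lhs => rw [← h2]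
      exact z.s_map _ _ _ _
    refine ⟨hs, ?_⟩
    rw [z.map_comp 0 (Λ.deg f) _ zero_le le_self_add h1 ha']
    congr 1

end Path

/-! ## The path groupoid -/

section PathGroupoid

variable (Λ : TopKGraph.{u, v} k)

/-- The integer vector `d(f) - d(g)`. -/
def degDiff (f g : Λ.Mor) : Fin k → ℤ := fun i => (Λ.deg f i : ℤ) - (Λ.deg g i : ℤ)

/-- The morphisms of the path groupoid: the triples `(f x, d(f) - d(g), g x)`, where `f`, `g` are
morphisms with `s(f) = s(g)` and `x` is a path with `r(x) = s(f)`. -/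
def PathArrow : Type (max u v) :=
  {t : Λ.Path × (Fin k → ℤ) × Λ.Path //
    ∃ (f g : Λ.Mor) (x : Λ.Path), Λ.s f = Λ.s g ∧ t.1.IsConcat f x ∧ t.2.2.IsConcat g x ∧
      t.2.1 = Λ.degDiff f g}

/-- `U *_s V`, the set of pairs in `U × V` with a common source. -/
def starS (U V : Set Λ.Mor) : Set (Λ.Mor × Λ.Mor) := {p | p.1 ∈ U ∧ p.2 ∈ V ∧ Λ.s p.1 = Λ.s p.2}

/-- `Z(F, m)`, the set of all `(f x, d(f) - d(g), g x)` with `(f, g) ∈ F` and `d(f) - d(g) = m`. -/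
def Z (F : Set (Λ.Mor × Λ.Mor)) (m : Fin k → ℤ) : Set Λ.PathArrow :=
  {t | ∃ (f g : Λ.Mor) (x : Λ.Path), (f, g) ∈ F ∧ t.1.1.IsConcat f x ∧ t.1.2.2.IsConcat g x ∧
    t.1.2.1 = Λ.degDiff f g ∧ Λ.degDiff f g = m}

/-- The topology on `G_Λ` with basic open sets `Z(U *_s V, m) ∩ Z(F, m)ᶜ`, where `U` and `V` are
open and `F ⊆ Λ *_s Λ` is compact. -/
instance : TopologicalSpace Λ.PathArrow :=
  TopologicalSpace.generateFrom
    {S | ∃ (m : Fin k → ℤ) (U V : Set Λ.Mor) (F : Set (Λ.Mor × Λ.Mor)), IsOpen U ∧ IsOpen V ∧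
      IsCompact F ∧ F ⊆ Λ.starS Set.univ Set.univ ∧ S = Λ.Z (Λ.starS U V) m ∩ (Λ.Z F m)ᶜ}

variable {Λ}

theorem src_eq {z w x : Λ.Path} {f g : Λ.Mor} (h : z.IsConcat f x) (h' : w.IsConcat g x) :
    Λ.s f = Λ.s g := by
  obtain ⟨hs, -⟩ := (h.extend 0 (fun i => by simp)).choose_spec.2.2
  obtain ⟨hs', -⟩ := (h'.extend 0 (fun i => by simp)).choose_spec.2.2
  exact hs.trans hs'.symm

theorem isConcat_refl (x : Λ.Path) :
    ∃ (f : Λ.Mor) (y : Λ.Path), x.IsConcat f y ∧ f = Λ.one (x.obj 0 (fun i => by simp)) :=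
  ⟨_, _, x.isConcat_shift 0 (fun i => by simp), x.map_self _ _⟩

/-- Two decompositions of the same path have a common refinement. -/
theorem refine_pair {w x y : Λ.Path} {g g' : Λ.Mor} (h : w.IsConcat g x)
    (h' : w.IsConcat g' y) :
    ∃ (a b : Fin k → ℕ) (ha : toENat a ≤ x.deg) (hb : toENat b ≤ y.deg),
      Λ.deg g + a = Λ.deg g' + b ∧ x.shift a ha = y.shift b hb := by
  obtain ⟨h1, h2, rfl⟩ := h
  obtain ⟨h1', h2', rfl⟩ := h'
  have e1 : Λ.deg g + (Λ.deg g ⊔ Λ.deg g' - Λ.deg g) = Λ.deg g ⊔ Λ.deg g' :=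
    add_tsub_cancel_of_le le_sup_left
  have e2 : Λ.deg g' + (Λ.deg g ⊔ Λ.deg g' - Λ.deg g') = Λ.deg g ⊔ Λ.deg g' :=
    add_tsub_cancel_of_le le_sup_right
  have hsup : toENat (Λ.deg g ⊔ Λ.deg g') ≤ w.deg := by
    intro i
    rcases le_total (Λ.deg g i) (Λ.deg g' i) with hle | hle
    · simpa [toENat, hle] using h1' i
    · simpa [toENat, hle] using h1 i
  refine ⟨_, _, (Path.le_add_iff h1).2 (by rw [e1]; exact hsup),
    (Path.le_add_iff h1').2 (by rw [e2]; exact hsup), e1.trans e2.symm, ?_⟩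
  exact (w.shift_shift _ _ h1 _).trans
    ((w.shift_congr (e1.trans e2.symm) _).trans (w.shift_shift _ _ h1' _).symm)

theorem pathArrow_comp_aux {z w v : Λ.Path} {m n : Fin k → ℤ}
    (h : ∃ (f g : Λ.Mor) (x : Λ.Path), Λ.s f = Λ.s g ∧ z.IsConcat f x ∧ w.IsConcat g x ∧
      m = Λ.degDiff f g)
    (h' : ∃ (f g : Λ.Mor) (x : Λ.Path), Λ.s f = Λ.s g ∧ w.IsConcat f x ∧ v.IsConcat g x ∧
      n = Λ.degDiff f g) :
    ∃ (f g : Λ.Mor) (x : Λ.Path), Λ.s f = Λ.s g ∧ z.IsConcat f x ∧ v.IsConcat g x ∧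
      m + n = Λ.degDiff f g := by
  obtain ⟨f, g, x, -, hz, hw, rfl⟩ := h
  obtain ⟨f', g', y, -, hw', hv, rfl⟩ := h'
  obtain ⟨a, b, ha, hb, hab, hxy⟩ := refine_pair hw hw'
  obtain ⟨f₁, hd, hf₁, -⟩ := hz.extend a ha
  obtain ⟨g₁, hd', hg₁, -⟩ := hv.extend b hb
  rw [← hxy] at hg₁
  refine ⟨f₁, g₁, _, src_eq hf₁ hg₁, hf₁, hg₁, ?_⟩
  funext i
  have := congrFun hab i
  simp only [degDiff, hd, hd', Pi.add_apply] at this ⊢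
  push_cast
  omega

variable (Λ)

/-- The path groupoid `G_Λ`: objects are paths, `r(x, m, y) = x`, `s(x, m, y) = y`,
`(x, m, y) (y, n, z) = (x, m + n, z)` and `(x, m, y)⁻¹ = (y, -m, x)`. -/
def pathGroupoid : TopGroupoid.{max u v, max u v} where
  Obj := Λ.Path
  Mor := Λ.PathArrow
  r t := t.1.1
  s t := t.1.2.2
  one x := ⟨(x, 0, x), by
    obtain ⟨f, y, h, -⟩ := isConcat_refl x
    exact ⟨f, f, y, rfl, h, h, by funext i; simp [degDiff]⟩⟩
  comp t t' h := ⟨(t.1.1, t.1.2.1 + t'.1.2.1, t'.1.2.2), by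
    have h2 := t'.2
    rw [← h] at h2
    exact pathArrow_comp_aux t.2 h2⟩
  r_one x := rfl
  s_one x := rfl
  r_comp t t' h := rfl
  s_comp t t' h := rfl
  one_comp t := Subtype.ext (by simp)
  comp_one t := Subtype.ext (by simp)
  assoc t t' t'' h h' := Subtype.ext (by simp [add_assoc])
  inv t := ⟨(t.1.2.2, -t.1.2.1, t.1.1), by
    obtain ⟨f, g, x, hs, h, h', hm⟩ := t.2
    exact ⟨g, f, x, hs.symm, h', h, by rw [hm]; funext i; simp [degDiff]⟩⟩
  r_inv t := rfl
  s_inv t := rfl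
  inv_comp t := Subtype.ext (by simp)
  comp_inv t := Subtype.ext (by simp)

/-- The set `∂Λ` of boundary paths. -/
def boundary : Set Λ.pathGroupoid.Obj := {x : Λ.Path | x.IsBoundary}

/-- The boundary-path groupoid `𝒢_Λ`, the reduction of `G_Λ` to `∂Λ`. -/
def boundaryGroupoid : TopGroupoid.{max u v, max u v} := Λ.pathGroupoid.reduction Λ.boundary

variable {Λ}
variable {A : Type w} [Group A] [TopologicalSpace A]

/-- The value of the induced cocycle: `c̃(f x, d(f) - d(g), g x) = c(f) c(g)⁻¹`, computed from any
decomposition. -/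
noncomputable def inducedFun (c : ContFunctor Λ.toArrCat A) (t : Λ.PathArrow) : A :=
  c.toFun t.2.choose * (c.toFun t.2.choose_spec.choose)⁻¹

theorem cocycle_wd (c : ContFunctor Λ.toArrCat A) {z w x x' : Λ.Path} {f g f' g' : Λ.Mor}
    (h1 : z.IsConcat f x) (h2 : w.IsConcat g x) (h1' : z.IsConcat f' x') (h2' : w.IsConcat g' x')
    (hd : Λ.degDiff f g = Λ.degDiff f' g') :
    c.toFun f * (c.toFun g)⁻¹ = c.toFun f' * (c.toFun g')⁻¹ := by
  obtain ⟨a, b, ha, hb, hab, hxy⟩ := refine_pair h1 h1'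
  have huniq : ∀ {z y y' : Λ.Path} {p q : Λ.Mor}, z.IsConcat p y → z.IsConcat q y' →
      Λ.deg p = Λ.deg q → p = q := by
    rintro z y y' p q ⟨e1, e2, -⟩ ⟨e1', e2', -⟩ hpq
    rw [← e2, ← e2']
    exact z.map_congr rfl hpq _ _
  obtain ⟨F, hF, cF, sF, eF⟩ := h1.extend a ha
  obtain ⟨F', hF', cF', sF', eF'⟩ := h1'.extend b hb
  obtain ⟨K, hK, cK, sK, eK⟩ := h2.extend a ha
  obtain ⟨K', hK', cK', sK', eK'⟩ := h2'.extend b hb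
  have h3 : F = F' := huniq cF cF' (by rw [hF, hF', hab])
  have h4 : K = K' := huniq cK cK' (by
    rw [hK, hK']
    funext i
    have e1 := congrFun hab i
    have e2 := congrFun hd i
    simp only [degDiff, Pi.add_apply] at e1 e2 ⊢
    omega)
  have c1 : c.toFun F * (c.toFun K)⁻¹ = c.toFun f * (c.toFun g)⁻¹ := by
    rw [eF, eK, c.map_comp, c.map_comp]; group
  have c2 : c.toFun F' * (c.toFun K')⁻¹ = c.toFun f' * (c.toFun g')⁻¹ := by
    rw [eF', eK', c.map_comp, c.map_comp]; group
  rw [← c1, ← c2, h3, h4]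

theorem inducedFun_eq (c : ContFunctor Λ.toArrCat A) (t : Λ.PathArrow) {f g : Λ.Mor} {x : Λ.Path}
    (h1 : t.1.1.IsConcat f x) (h2 : t.1.2.2.IsConcat g x) (hd : t.1.2.1 = Λ.degDiff f g) :
    inducedFun c t = c.toFun f * (c.toFun g)⁻¹ := by
  obtain ⟨-, e1, e2, e3⟩ := t.2.choose_spec.choose_spec.choose_spec
  exact cocycle_wd c e1 e2 h1 h2 (e3.symm.trans hd)

/-- The continuous functor `c̃ : G_Λ → A` induced by a continuous functor `c : Λ → A`. -/
noncomputable def inducedCocycle [IsTopologicalGroup A] (c : ContFunctor Λ.toArrCat A) :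
    ContFunctor Λ.pathGroupoid.toArrCat A where
  toFun := inducedFun c
  map_one x := by
    obtain ⟨f, y, h, -⟩ := isConcat_refl x
    rw [inducedFun_eq c (Λ.pathGroupoid.one x) (f := f) (g := f) (x := y) h h
      (by funext i; simp [degDiff, pathGroupoid])]
    group
  map_comp := by
    rintro ⟨⟨z, m, w⟩, ht⟩ ⟨⟨w', n, v⟩, ht'⟩ h
    obtain rfl : w = w' := h
    obtain ⟨f, g, x, -, hz, hw, hm⟩ := id ht
    obtain ⟨f', g', y, -, hw', hv, hn⟩ := id ht'
    dsimp only at hz hw hm hw' hv hn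
    obtain ⟨a, b, ha, hb, hab, hxy⟩ := refine_pair hw hw'
    obtain ⟨F, hF, cF, sF, eF⟩ := hz.extend a ha
    obtain ⟨K, hK, cK, sK, eK⟩ := hw.extend a ha
    obtain ⟨K', hK', cK', sK', eK'⟩ := hw'.extend b hb
    obtain ⟨L, hL, cL, sL, eL⟩ := hv.extend b hb
    have hKK : K = K' := by
      obtain ⟨_, e2, -⟩ := cK
      obtain ⟨_, e2', -⟩ := cK'
      rw [← e2, ← e2']
      exact w.map_congr rfl (by rw [hK, hK', hab]) _ _
    rw [← hxy] at cL
    refine (inducedFun_eq c _ (f := F) (g := L) cF cL ?_).trans ?_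
    · funext i
      have e := congrFun hab i
      change m i + n i = _
      simp only [hm, hn, degDiff, hF, hL, Pi.add_apply] at e ⊢
      push_cast
      omega
    refine Eq.trans ?_ (congrArg₂ (· * ·) (inducedFun_eq c _ (f := f) (g := g) hz hw hm)
      (inducedFun_eq c _ (f := f') (g := g') hw' hv hn)).symm
    have c1 : c.toFun F * (c.toFun K)⁻¹ = c.toFun f * (c.toFun g)⁻¹ := by
      rw [eF, eK, c.map_comp, c.map_comp]; group
    have c2 : c.toFun K' * (c.toFun L)⁻¹ = c.toFun f' * (c.toFun g')⁻¹ := by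
      rw [eK', eL, c.map_comp, c.map_comp]; group
    rw [← c1, ← c2, hKK]; group
  continuous_toFun := by
    change Continuous (inducedFun c)
    rw [continuous_iff_continuousAt]
    intro t W hW
    obtain ⟨f, g, x, hs, h1, h2, hd⟩ := t.2
    rw [inducedFun_eq c t h1 h2 hd] at hW
    have hcont : Continuous fun p : Λ.Mor × Λ.Mor => c.toFun p.1 * (c.toFun p.2)⁻¹ := by
      have := c.continuous_toFun
      fun_prop
    have hN := hcont.continuousAt (x := (f, g)) hW
    rw [Filter.mem_map, mem_nhds_prod_iff'] at hN
    obtain ⟨U, V, hU, hfU, hV, hgV, hUV⟩ := hN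
    have hO : IsOpen (Λ.Z (Λ.starS U V) t.1.2.1 ∩ (Λ.Z ∅ t.1.2.1)ᶜ) :=
      TopologicalSpace.isOpen_generateFrom_of_mem
        ⟨_, U, V, ∅, hU, hV, isCompact_empty, Set.empty_subset _, rfl⟩
    rw [Filter.mem_map]
    refine Filter.mem_of_superset (hO.mem_nhds ⟨⟨f, g, x, ⟨hfU, hgV, hs⟩, h1, h2, hd, hd.symm⟩, ?_⟩)
      ?_
    · rintro ⟨_, _, _, h, -⟩
      exact h
    · rintro t' ⟨⟨f', g', x', ⟨hf', hg', -⟩, h1', h2', hd', -⟩, -⟩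
      change inducedFun c t' ∈ W
      rw [inducedFun_eq c t' h1' h2' hd']
      exact hUV (Set.mk_mem_prod hf' hg')

end PathGroupoid

end TopKGraph

end HRGraph

/-!
The isomorphism sends `((x, m, y), a)` to `(x̂, m, ŷ)`, where `x̂` and `ŷ` are the unique lifts of
`x` and `y` to paths of `Λ ×_c A` starting at group coordinates `a` and `a c̃(x, m, y)`.

For the topology, attach to an arrow `t` the set `D(t)` of pairs `(f, g)` such that
`t = (f x, d(f) - d(g), g x)` for some path `x`. The topology of `G_Λ` is the coarsest one for which
the integer vector of `t` depends continuously on `t`, `t ↦ D(t)` is lower hemicontinuous and the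
relation `(f, g) ∈ D(t)` is closed. The last condition replaces the sets `Z(F, m)` with `F` compact,
because `Λ` is locally compact and each `D(t)` is closed. These three properties are easy to carry
through the bijection between `D(t)` and the set of decompositions of the lift of `t`, without any
compactness argument in `A`.

A compact exhaustive set `E` at `v` gives the compact exhaustive sets `E × N` at `(v, a)`, with `N`
a compact neighbourhood of `a`; conversely a compact exhaustive set at `(v, a)` restricts to one at
`v` by taking its slice at `a`. Hence a path is a boundary path if and only if its lifts are.
-/

namespace HRGraph

open Topology

namespace TopGroupoid

/-- An isomorphism of groupoids which is a homeomorphism on morphisms is an isomorphism of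
topological groupoids, since units carry the subspace topology. -/
def Iso.ofMor {G H : TopGroupoid} (obj : G.Obj ≃ H.Obj) (mor : G.Mor ≃ₜ H.Mor)
    (map_r : ∀ f, H.r (mor f) = obj (G.r f)) (map_s : ∀ f, H.s (mor f) = obj (G.s f))
    (map_one : ∀ a, mor (G.one a) = H.one (obj a))
    (map_comp : ∀ (f g : G.Mor) (h : G.s f = G.r g), mor (G.comp f g h)
      = H.comp (mor f) (mor g) ((map_s f).trans ((congrArg obj h).trans (map_r g).symm))) :
    Iso G H where
  obj :=
    { obj with
      continuous_toFun := continuous_induced_rng.2 <| by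
        have one_comp_obj : H.one ∘ obj = mor ∘ G.one := funext fun a => (map_one a).symm
        exact one_comp_obj ▸ mor.continuous.comp continuous_induced_dom
      continuous_invFun := continuous_induced_rng.2 <| by
        have one_comp_symm : G.one ∘ obj.symm = mor.symm ∘ H.one := funext fun a => by
          simp [Homeomorph.eq_symm_apply, map_one]
        exact one_comp_symm ▸ mor.symm.continuous.comp continuous_induced_dom }
  mor := mor
  map_r := map_r
  map_s := map_s
  map_one := map_one
  map_comp := map_comp

/-- The composition of two isomorphisms of topological groupoids. -/
def Iso.trans {G H K : TopGroupoid} (φ : Iso G H) (ψ : Iso H K) : Iso G K where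
  obj := φ.obj.trans ψ.obj
  mor := φ.mor.trans ψ.mor
  map_r f := (ψ.map_r _).trans (congrArg ψ.obj (φ.map_r f))
  map_s f := (ψ.map_s _).trans (congrArg ψ.obj (φ.map_s f))
  map_one a := (congrArg ψ.mor (φ.map_one a)).trans (ψ.map_one _)
  map_comp f g h := (congrArg ψ.mor (φ.map_comp f g h)).trans (ψ.map_comp _ _ _)

/-- The restriction of an isomorphism to reductions by corresponding sets of units. -/
def Iso.reduction {G H : TopGroupoid} (φ : Iso G H) {Y : Set G.Obj} {Y' : Set H.Obj}
    (hY : ∀ y, φ.obj y ∈ Y' ↔ y ∈ Y) : Iso (G.reduction Y) (H.reduction Y') :=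
  Iso.ofMor (G := G.reduction Y) (H := H.reduction Y')
    (φ.obj.toEquiv.subtypeEquiv fun y => (hY y).symm)
    (φ.mor.subtype fun f => by rw [φ.map_r, φ.map_s, hY, hY])
    (fun f => Subtype.ext (φ.map_r f.1))
    (fun f => Subtype.ext (φ.map_s f.1))
    (fun a => Subtype.ext (φ.map_one a.1))
    (fun f g h => Subtype.ext (φ.map_comp f.1 g.1 (congrArg Subtype.val h)))

/-- Skew products commute with reductions: `(G|_Y)(b) ≅ G(b)|_{Y × A}`. -/
def reductionSkewIso {G : TopGroupoid} {A : Type*} [Group A] [TopologicalSpace A]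
    (b : ContFunctor G.toArrCat A) (Y : Set G.Obj) :
    Iso ((G.reduction Y).skew (restrict b Y)) ((G.skew b).reduction (Prod.fst ⁻¹' Y)) :=
  Iso.ofMor (G := (G.reduction Y).skew (restrict b Y))
    (H := (G.skew b).reduction (Prod.fst ⁻¹' Y))
    { toFun := fun p => ⟨(p.1.1, p.2), p.1.2⟩
      invFun := fun q => (⟨q.1.1, q.2⟩, q.1.2) }
    { toFun := fun p => ⟨(p.1.1, p.2), p.1.2⟩
      invFun := fun q => (⟨q.1.1, q.2⟩, q.1.2)
      continuous_toFun := by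
        change Continuous fun p : {f : G.Mor // G.r f ∈ Y ∧ G.s f ∈ Y} × A =>
          (⟨(p.1.1, p.2), p.1.2⟩ : {q : G.Mor × A // G.r q.1 ∈ Y ∧ G.s q.1 ∈ Y})
        fun_prop
      continuous_invFun := by
        change Continuous fun q : {q : G.Mor × A // G.r q.1 ∈ Y ∧ G.s q.1 ∈ Y} =>
          ((⟨q.1.1, q.2⟩, q.1.2) : {f : G.Mor // G.r f ∈ Y ∧ G.s f ∈ Y} × A)
        fun_prop }
    (fun _ => rfl) (fun _ => rfl) (fun _ => rfl) (fun _ _ _ => rfl)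

end TopGroupoid

theorem lowerHemicontinuous_image_prodMk {X Y Z B : Type*} [TopologicalSpace X]
    [TopologicalSpace Y] [TopologicalSpace Z] [TopologicalSpace B] {D : X → Set Y}
    (hD : LowerHemicontinuous D) {g : Y × B → Z} (hg : Continuous g) :
    LowerHemicontinuous fun q : X × B => (fun y => g (y, q.2)) '' D q.1 := by
  refine fun q => lowerHemicontinuousAt_iff.2 fun O hO => ?_
  rintro ⟨_, ⟨y, hy, rfl⟩, hyO⟩
  obtain ⟨W, N, hW, hyW, hN, hbN, hWN⟩ := mem_nhds_prod_iff'.1 ((hO.preimage hg).mem_nhds hyO)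
  filter_upwards [prod_mem_nhds (lowerHemicontinuousAt_iff.1 (hD q.1) W hW ⟨y, hy, hyW⟩)
    (hN.mem_nhds hbN)]
  rintro ⟨x', b'⟩ ⟨⟨y', hy', hyW'⟩, hb'⟩
  exact ⟨_, ⟨y', hy', rfl⟩, hWN ⟨hyW', hb'⟩⟩

theorem isClosed_of_injOn_discrete {X Y : Type*} [TopologicalSpace X] [T1Space X]
    [TopologicalSpace Y] [DiscreteTopology Y] {f : X → Y} (hf : Continuous f) {S : Set X}
    (hS : Set.InjOn f S) : IsClosed S := by
  refine isOpen_compl_iff.1 (isOpen_iff_mem_nhds.2 fun x hx => ?_)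
  have fibre_mem_nhds : f ⁻¹' {f x} ∈ 𝓝 x := ((isOpen_discrete _).preimage hf).mem_nhds rfl
  have fibre_subsingleton : (S ∩ f ⁻¹' {f x}).Subsingleton := fun y hy z hz =>
    hS hy.1 hz.1 (hy.2.trans hz.2.symm)
  filter_upwards [fibre_mem_nhds,
    fibre_subsingleton.isClosed.isOpen_compl.mem_nhds fun h => hx h.1] with y hy hyS hy'
  exact hyS ⟨hy', hy⟩

theorem isClosed_setOf_inter_nonempty {X Y : Type*} [TopologicalSpace X] [TopologicalSpace Y]
    {D : X → Set Y} (hD : IsClosed {q : X × Y | q.2 ∈ D q.1}) {K : Set Y} (hK : IsCompact K) :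
    IsClosed {x | (D x ∩ K).Nonempty} := by
  have : CompactSpace K := isCompact_iff_compactSpace.1 hK
  have isClosed_graph : IsClosed {q : X × K | (q.2 : Y) ∈ D q.1} :=
    hD.preimage (continuous_fst.prodMk (continuous_subtype_val.comp continuous_snd))
  convert isClosedMap_fst_of_compactSpace _ isClosed_graph using 1
  ext x
  exact ⟨fun ⟨y, hy, hyK⟩ => ⟨(x, ⟨y, hyK⟩), hy, rfl⟩,
    fun ⟨⟨_, y⟩, hy, hx⟩ => ⟨y, hx ▸ hy, y.2⟩⟩

namespace TopKGraph

variable {k : ℕ} {Λ : TopKGraph.{u, v} k}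

section Decompositions

theorem Path.IsConcat.eq_of_deg_eq {z x x' : Λ.Path} {f f' : Λ.Mor} (h : z.IsConcat f x)
    (h' : z.IsConcat f' x') (hd : Λ.deg f = Λ.deg f') : f = f' := by
  obtain ⟨_, map_f, -⟩ := h
  obtain ⟨_, map_f', -⟩ := h'
  rw [← map_f, ← map_f']
  exact z.map_congr rfl hd _ _

/-- The set of pairs `(f, g)` such that `t = (f x, d(f) - d(g), g x)` for some path `x`. -/
def decompositions (t : Λ.PathArrow) : Set (Λ.Mor × Λ.Mor) :=
  {p | ∃ x, t.1.1.IsConcat p.1 x ∧ t.1.2.2.IsConcat p.2 x ∧ t.1.2.1 = Λ.degDiff p.1 p.2}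

theorem decompositions_nonempty (t : Λ.PathArrow) : (decompositions t).Nonempty :=
  let ⟨f, g, x, _, hf, hg, hd⟩ := t.2
  ⟨(f, g), x, hf, hg, hd⟩

theorem source_eq_of_mem_decompositions {t : Λ.PathArrow} {p : Λ.Mor × Λ.Mor}
    (hp : p ∈ decompositions t) : Λ.s p.1 = Λ.s p.2 :=
  let ⟨_, hf, hg, _⟩ := hp
  src_eq hf hg

theorem mem_Z_iff {t : Λ.PathArrow} {F : Set (Λ.Mor × Λ.Mor)} {m : Fin k → ℤ} :
    t ∈ Λ.Z F m ↔ t.1.2.1 = m ∧ (decompositions t ∩ F).Nonempty := by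
  constructor
  · rintro ⟨f, g, x, hF, hf, hg, hd, hm⟩
    exact ⟨hd.trans hm, (f, g), ⟨x, hf, hg, hd⟩, hF⟩
  · rintro ⟨hm, ⟨f, g⟩, ⟨x, hf, hg, hd⟩, hF⟩
    exact ⟨f, g, x, hF, hf, hg, hd, hd.symm.trans hm⟩

theorem decompositions_inter_starS (t : Λ.PathArrow) (U V : Set Λ.Mor) :
    decompositions t ∩ Λ.starS U V = decompositions t ∩ U ×ˢ V :=
  Set.ext fun _ => ⟨fun h => ⟨h.1, h.2.1, h.2.2.1⟩,
    fun h => ⟨h.1, h.2.1, h.2.2, source_eq_of_mem_decompositions h.1⟩⟩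

theorem isClosed_starS_univ : IsClosed (Λ.starS Set.univ Set.univ) := by
  have continuous_s := Λ.isLocalHomeomorph_s.continuous
  simp only [starS, Set.mem_univ, true_and]
  exact isClosed_eq (continuous_s.comp continuous_fst) (continuous_s.comp continuous_snd)

theorem isOpen_setOf_decompositions {U V : Set Λ.Mor} (hU : IsOpen U) (hV : IsOpen V)
    {K : Set (Λ.Mor × Λ.Mor)} (hK : IsCompact K) (m : Fin k → ℤ) :
    IsOpen {t : Λ.PathArrow | t.1.2.1 = m ∧ (decompositions t ∩ U ×ˢ V).Nonempty ∧
      ¬ (decompositions t ∩ K).Nonempty} := by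
  have basic_open : IsOpen
      (Λ.Z (Λ.starS U V) m ∩ (Λ.Z (K ∩ Λ.starS Set.univ Set.univ) m)ᶜ) :=
    TopologicalSpace.isOpen_generateFrom_of_mem ⟨m, U, V, _, hU, hV,
      hK.inter_right isClosed_starS_univ, Set.inter_subset_right, rfl⟩
  convert basic_open using 1
  ext t
  have inter_relation : decompositions t ∩ (K ∩ Λ.starS Set.univ Set.univ)
      = decompositions t ∩ K := by
    rw [Set.inter_left_comm, decompositions_inter_starS, Set.univ_prod_univ, Set.inter_univ,
      Set.inter_comm]
  simp only [Set.mem_ofPred_eq, Set.mem_inter_iff, Set.mem_compl_iff, mem_Z_iff,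
    decompositions_inter_starS, inter_relation]
  tauto

theorem continuous_pathArrow_degree : Continuous fun t : Λ.PathArrow => t.1.2.1 := by
  refine continuous_discrete_rng.2 fun m => ?_
  convert isOpen_setOf_decompositions (Λ := Λ) isOpen_univ isOpen_univ isCompact_empty m using 1
  ext t
  simp [decompositions_nonempty]

theorem lowerHemicontinuous_decompositions :
    LowerHemicontinuous (decompositions : Λ.PathArrow → Set (Λ.Mor × Λ.Mor)) := by
  refine fun t => lowerHemicontinuousAt_iff.2 fun O hO => ?_
  rintro ⟨p, hp, hpO⟩
  obtain ⟨U, V, hU, hpU, hV, hpV, hUV⟩ := mem_nhds_prod_iff'.1 (hO.mem_nhds hpO)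
  filter_upwards [(isOpen_setOf_decompositions hU hV isCompact_empty t.1.2.1).mem_nhds
    ⟨rfl, ⟨p, hp, hpU, hpV⟩, by simp⟩] with t' ht'
  exact ht'.2.1.mono (Set.inter_subset_inter_right _ hUV)

theorem isClosed_decompositions (t : Λ.PathArrow) : IsClosed (decompositions t) := by
  have continuous_degrees : Continuous fun p : Λ.Mor × Λ.Mor => (Λ.deg p.1, Λ.deg p.2) :=
    Λ.continuous_deg.prodMap Λ.continuous_deg
  refine isClosed_of_injOn_discrete continuous_degrees ?_
  rintro p ⟨x, hf, hg, -⟩ q ⟨y, hf', hg', -⟩ hpq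
  exact Prod.ext (hf.eq_of_deg_eq hf' (congrArg Prod.fst hpq))
    (hg.eq_of_deg_eq hg' (congrArg Prod.snd hpq))

theorem isClosed_setOf_mem_decompositions :
    IsClosed {q : Λ.PathArrow × (Λ.Mor × Λ.Mor) | q.2 ∈ decompositions q.1} := by
  refine isOpen_compl_iff.1 (isOpen_iff_mem_nhds.2 ?_)
  rintro ⟨t, p⟩ (hp : p ∉ decompositions t)
  obtain ⟨K, hpK, hKt, hK⟩ :=
    local_compact_nhds ((isClosed_decompositions t).isOpen_compl.mem_nhds hp)
  have disjoint_near : ∀ᶠ t' in 𝓝 t, ¬ (decompositions t' ∩ K).Nonempty := by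
    filter_upwards [(isOpen_setOf_decompositions isOpen_univ isOpen_univ hK t.1.2.1).mem_nhds
      ⟨rfl, by simpa using decompositions_nonempty t, fun ⟨q, hq, hqK⟩ => hKt hqK hq⟩] with t' ht'
    exact ht'.2.2
  filter_upwards [prod_mem_nhds disjoint_near hpK]
  rintro ⟨t', p'⟩ ⟨ht', hp'⟩ hmem
  exact ht' ⟨p', hmem, hp'⟩

theorem continuous_of_decompositions {X : Type*} [TopologicalSpace X] {φ : X → Λ.PathArrow}
    (hdeg : Continuous fun x => (φ x).1.2.1)
    (hlower : LowerHemicontinuous fun x => decompositions (φ x))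
    (hclosed : IsClosed {q : X × (Λ.Mor × Λ.Mor) | q.2 ∈ decompositions (φ q.1)}) :
    Continuous φ := by
  have isOpen_deg (m : Fin k → ℤ) : IsOpen {x | (φ x).1.2.1 = m} :=
    (isOpen_discrete {m}).preimage hdeg
  refine continuous_generateFrom_iff.2 ?_
  rintro _ ⟨m, U, V, F, hU, hV, hF, -, rfl⟩
  have isOpen_hit : IsOpen {x | (decompositions (φ x) ∩ U ×ˢ V).Nonempty} :=
    lowerHemicontinuous_iff_isOpen_inter_nonempty.1 hlower _ (hU.prod hV)
  have isOpen_miss : IsOpen {x | (decompositions (φ x) ∩ F).Nonempty}ᶜ :=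
    (isClosed_setOf_inter_nonempty hclosed hF).isOpen_compl
  convert (isOpen_deg m).inter (isOpen_hit.inter isOpen_miss) using 1
  ext x
  simp only [Set.mem_preimage, Set.mem_inter_iff, Set.mem_compl_iff, Set.mem_ofPred_eq, mem_Z_iff,
    decompositions_inter_starS]
  tauto

end Decompositions

section SkewPaths

variable {A : Type w} [Group A] [TopologicalSpace A] [IsTopologicalGroup A]
  [LocallyCompactSpace A] [T2Space A] {c : ContFunctor Λ.toArrCat A}

theorem toENat_mono : Monotone (toENat : (Fin k → ℕ) → Fin k → ℕ∞) :=
  fun _ _ h i => Nat.cast_le.2 (h i)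

theorem toENat_zero_le (d : Fin k → ℕ∞) : toENat 0 ≤ d := fun _ => by simp

namespace Path

/-- The group coordinate of the range of a path of the skew product. -/
def groupCoord (y : (Λ.skew c).Path) : A := (y.obj 0 (toENat_zero_le _)).2

variable (c) in
/-- The lift of a path of `Λ` to the path of the skew product with group coordinate `a`. -/
def lift (x : Λ.Path) (a : A) : (Λ.skew c).Path where
  deg := x.deg
  obj p hp := (x.obj p hp, a * c.toFun (x.map 0 p zero_le hp))
  map p q hpq hq := (x.map p q hpq hq, a * c.toFun (x.map 0 p zero_le ((toENat_mono hpq).trans hq)))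
  r_map p q hpq hq hp := Prod.ext (x.r_map _ _ _ _ _) rfl
  s_map p q hpq hq := Prod.ext (x.s_map _ _ _ _) <| by
    rw [x.map_comp 0 p q zero_le hpq ((toENat_mono hpq).trans hq) hq, c.map_comp, ← mul_assoc]
    rfl
  map_self p hp := Prod.ext (x.map_self _ _) rfl
  map_comp n p q hnp hpq hp hq := Prod.ext (x.map_comp _ _ _ _ _ _ _) rfl
  deg_map p q hpq hq := x.deg_map _ _ _ _

/-- The projection of a path of the skew product to `Λ`. -/
def proj (y : (Λ.skew c).Path) : Λ.Path where
  deg := y.deg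
  obj p hp := (y.obj p hp).1
  map p q hpq hq := (y.map p q hpq hq).1
  r_map p q hpq hq hp := congrArg Prod.fst (y.r_map p q hpq hq hp)
  s_map p q hpq hq := congrArg Prod.fst (y.s_map p q hpq hq)
  map_self p hp := congrArg Prod.fst (y.map_self p hp)
  map_comp n p q hnp hpq hp hq := congrArg Prod.fst (y.map_comp n p q hnp hpq hp hq)
  deg_map p q hpq hq := y.deg_map p q hpq hq

theorem snd_obj (y : (Λ.skew c).Path) (p : Fin k → ℕ) (hp : toENat p ≤ y.deg) :
    (y.obj p hp).2 = y.groupCoord * c.toFun (y.proj.map 0 p zero_le hp) := by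
  have range_coord : (y.map 0 p zero_le hp).2 = y.groupCoord :=
    congrArg Prod.snd (y.r_map 0 p zero_le hp (toENat_zero_le _))
  have source_coord : (y.map 0 p zero_le hp).2 * c.toFun (y.map 0 p zero_le hp).1
      = (y.obj p hp).2 := congrArg Prod.snd (y.s_map 0 p zero_le hp)
  rw [← source_coord, range_coord]
  rfl

theorem groupCoord_lift (x : Λ.Path) (a : A) : (x.lift c a).groupCoord = a := by
  change a * c.toFun (x.map 0 0 zero_le (toENat_zero_le _)) = a
  rw [x.map_self, c.map_one, mul_one]

theorem lift_proj_groupCoord (y : (Λ.skew c).Path) : y.proj.lift c y.groupCoord = y :=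
  ext' rfl fun p q hpq hq _ => Prod.ext rfl <| by
    have hp : toENat p ≤ y.deg := (toENat_mono hpq).trans hq
    exact (snd_obj y p hp).symm.trans (congrArg Prod.snd (y.r_map p q hpq hq hp)).symm

variable (c) in
/-- Paths of the skew product are paths of `Λ` together with a group coordinate. -/
def liftEquiv : Λ.Path × A ≃ (Λ.skew c).Path where
  toFun p := p.1.lift c p.2
  invFun y := (y.proj, y.groupCoord)
  left_inv p := Prod.ext rfl (groupCoord_lift p.1 p.2)
  right_inv y := lift_proj_groupCoord y

theorem IsConcat.lift {z x : Λ.Path} {f : Λ.Mor} (h : z.IsConcat f x) (a : A) :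
    (z.lift c a).IsConcat (f, a) (x.lift c (a * c.toFun f)) := by
  obtain ⟨hf, map_f, rfl⟩ := h
  refine ⟨hf, Prod.ext map_f (groupCoord_lift z a), ext' rfl fun p q hpq hq _ => Prod.ext rfl ?_⟩
  have hp := (le_add_iff hf).1 ((toENat_mono hpq).trans hq)
  change a * c.toFun (z.map 0 (Λ.deg f + p) _ hp)
    = a * c.toFun f * c.toFun (z.map (Λ.deg f + 0) (Λ.deg f + p) _ _)
  rw [z.map_comp 0 (Λ.deg f) (Λ.deg f + p) zero_le le_self_add hf hp, c.map_comp, map_f,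
    mul_assoc]
  congr 3

theorem IsConcat.proj {z x : (Λ.skew c).Path} {f : (Λ.skew c).Mor} (h : z.IsConcat f x) :
    z.proj.IsConcat f.1 x.proj := by
  obtain ⟨hf, map_f, rfl⟩ := h
  exact ⟨hf, congrArg Prod.fst map_f, rfl⟩

theorem IsConcat.groupCoord_eq {z x : (Λ.skew c).Path} {f : (Λ.skew c).Mor}
    (h : z.IsConcat f x) : z.groupCoord = f.2 := by
  obtain ⟨hf, map_f, -⟩ := h
  exact (congrArg Prod.snd (z.r_map 0 _ zero_le hf (toENat_zero_le _))).symm.trans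
    (congrArg Prod.snd map_f)

end Path

variable (c) in
/-- The pair of morphisms of the skew product over `(f, g)` which has `f` at the coordinate `a`,
and `g` at the coordinate that gives both the same source if `f` and `g` have the same source. -/
def liftPair (p : (Λ.Mor × Λ.Mor) × A) : (Λ.skew c).Mor × (Λ.skew c).Mor :=
  ((p.1.1, p.2), (p.1.2, p.2 * (c.toFun p.1.1 * (c.toFun p.1.2)⁻¹)))

/-- The projection of a pair of morphisms of the skew product to `Λ`. -/
def projPair (q : (Λ.skew c).Mor × (Λ.skew c).Mor) : Λ.Mor × Λ.Mor := (q.1.1, q.2.1)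

theorem continuous_liftPair : Continuous (liftPair c) := by
  have continuous_c := c.continuous_toFun
  change Continuous fun p : (Λ.Mor × Λ.Mor) × A =>
    ((p.1.1, p.2), (p.1.2, p.2 * (c.toFun p.1.1 * (c.toFun p.1.2)⁻¹)))
  fun_prop

theorem continuous_projPair : Continuous (projPair (c := c)) := by
  change Continuous fun q : (Λ.Mor × A) × (Λ.Mor × A) => (q.1.1, q.2.1)
  fun_prop

theorem liftPair_projPair {q : (Λ.skew c).Mor × (Λ.skew c).Mor}
    (hq : (Λ.skew c).s q.1 = (Λ.skew c).s q.2) : liftPair c (projPair q, q.1.2) = q := by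
  have source_coord : q.1.2 * c.toFun q.1.1 = q.2.2 * c.toFun q.2.1 := congrArg Prod.snd hq
  refine Prod.ext rfl (Prod.ext rfl ?_)
  change q.1.2 * (c.toFun q.1.1 * (c.toFun q.2.1)⁻¹) = q.2.2
  rw [← mul_assoc, source_coord, mul_inv_cancel_right]

theorem isConcat_liftPair_snd {w x : Λ.Path} {f g : Λ.Mor} (h : w.IsConcat g x) (a : A) :
    (w.lift c (a * (c.toFun f * (c.toFun g)⁻¹))).IsConcat (liftPair c ((f, g), a)).2
      (x.lift c (a * c.toFun f)) := by
  have source_coord : a * (c.toFun f * (c.toFun g)⁻¹) * c.toFun g = a * c.toFun f := by group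
  exact source_coord ▸ h.lift (a * (c.toFun f * (c.toFun g)⁻¹))

end SkewPaths

section SkewArrows

variable {A : Type w} [Group A] [TopologicalSpace A] [IsTopologicalGroup A]
  [LocallyCompactSpace A] [T2Space A] {c : ContFunctor Λ.toArrCat A}

variable (c) in
/-- The arrow of `G_{Λ ×_c A}` over the arrow `t` of `G_Λ` whose range has group coordinate `a`. -/
noncomputable def liftArrow (t : Λ.PathArrow) (a : A) : (Λ.skew c).PathArrow :=
  ⟨(t.1.1.lift c a, t.1.2.1, t.1.2.2.lift c (a * inducedFun c t)), by
    obtain ⟨f, g, x, -, hf, hg, hd⟩ := t.2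
    have hf' := hf.lift (c := c) a
    have hg' := isConcat_liftPair_snd (c := c) (f := f) hg a
    rw [inducedFun_eq c t hf hg hd]
    exact ⟨_, _, _, src_eq hf' hg', hf', hg', hd⟩⟩

/-- The projection of an arrow of `G_{Λ ×_c A}` to `G_Λ`. -/
def projArrow (t : (Λ.skew c).PathArrow) : Λ.PathArrow :=
  ⟨(t.1.1.proj, t.1.2.1, t.1.2.2.proj),
    let ⟨f, g, x, hs, hf, hg, hd⟩ := t.2
    ⟨f.1, g.1, x.proj, congrArg Prod.fst hs, hf.proj, hg.proj, hd⟩⟩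

theorem liftPair_mem_decompositions {t : Λ.PathArrow} {p : Λ.Mor × Λ.Mor}
    (hp : p ∈ decompositions t) (a : A) :
    liftPair c (p, a) ∈ decompositions (liftArrow c t a) := by
  obtain ⟨x, hf, hg, hd⟩ := hp
  refine ⟨x.lift c (a * c.toFun p.1), hf.lift a, ?_, hd⟩
  change (t.1.2.2.lift c (a * inducedFun c t)).IsConcat _ _
  rw [inducedFun_eq c t hf hg hd]
  exact isConcat_liftPair_snd hg a

theorem projPair_mem_decompositions {t : (Λ.skew c).PathArrow}
    {q : (Λ.skew c).Mor × (Λ.skew c).Mor} (hq : q ∈ decompositions t) :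
    projPair q ∈ decompositions (projArrow t) :=
  let ⟨x, hf, hg, hd⟩ := hq
  ⟨x.proj, hf.proj, hg.proj, hd⟩

theorem groupCoord_eq_of_mem_decompositions {t : (Λ.skew c).PathArrow}
    {q : (Λ.skew c).Mor × (Λ.skew c).Mor} (hq : q ∈ decompositions t) :
    t.1.1.groupCoord = q.1.2 :=
  let ⟨_, hf, _⟩ := hq
  hf.groupCoord_eq

theorem mem_decompositions_liftArrow_iff {t : Λ.PathArrow} {a : A}
    {q : (Λ.skew c).Mor × (Λ.skew c).Mor} :
    q ∈ decompositions (liftArrow c t a)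
      ↔ projPair q ∈ decompositions t ∧ liftPair c (projPair q, a) = q := by
  refine ⟨fun hq => ⟨projPair_mem_decompositions hq, ?_⟩,
    fun ⟨hq, lift_eq⟩ => lift_eq ▸ liftPair_mem_decompositions hq a⟩
  have coord_eq : q.1.2 = a :=
    (groupCoord_eq_of_mem_decompositions hq).symm.trans (Path.groupCoord_lift _ _)
  exact coord_eq ▸ liftPair_projPair (source_eq_of_mem_decompositions hq)

theorem decompositions_liftArrow (t : Λ.PathArrow) (a : A) :
    decompositions (liftArrow c t a) = (fun p => liftPair c (p, a)) '' decompositions t := by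
  ext q
  rw [mem_decompositions_liftArrow_iff]
  exact ⟨fun ⟨hq, lift_eq⟩ => ⟨_, hq, lift_eq⟩, fun ⟨_, hp, lift_eq⟩ => lift_eq ▸ ⟨hp, rfl⟩⟩

theorem liftArrow_projArrow (t : (Λ.skew c).PathArrow) :
    liftArrow c (projArrow t) t.1.1.groupCoord = t := by
  obtain ⟨f, g, x, hs, hf, hg, hd⟩ := t.2
  have source_coord : t.1.1.groupCoord * inducedFun c (projArrow t) = t.1.2.2.groupCoord := by
    rw [inducedFun_eq c (projArrow t) hf.proj hg.proj hd, hf.groupCoord_eq, hg.groupCoord_eq]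
    exact congrArg (fun q => q.2.2) (liftPair_projPair (q := (f, g)) hs)
  refine Subtype.ext (Prod.ext (Path.lift_proj_groupCoord _) (Prod.ext rfl ?_))
  change t.1.2.2.proj.lift c (t.1.1.groupCoord * inducedFun c (projArrow t)) = t.1.2.2
  rw [source_coord, Path.lift_proj_groupCoord]

theorem mem_decompositions_projArrow_iff {t : (Λ.skew c).PathArrow} {p : Λ.Mor × Λ.Mor} :
    p ∈ decompositions (projArrow t) ↔ liftPair c (p, t.1.1.groupCoord) ∈ decompositions t := by
  conv_rhs => rw [← liftArrow_projArrow t, mem_decompositions_liftArrow_iff]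
  rw [liftArrow_projArrow]
  exact (and_iff_left rfl).symm

theorem decompositions_projArrow (t : (Λ.skew c).PathArrow) :
    decompositions (projArrow t) = projPair '' decompositions t :=
  Set.Subset.antisymm (fun _ hp => ⟨_, mem_decompositions_projArrow_iff.1 hp, rfl⟩)
    (Set.image_subset_iff.2 fun _ => projPair_mem_decompositions)

theorem continuous_liftArrow : Continuous fun q : Λ.PathArrow × A => liftArrow c q.1 q.2 := by
  refine continuous_of_decompositions
    (continuous_pathArrow_degree.comp (f := Prod.fst) continuous_fst) ?_ ?_
  · simp only [decompositions_liftArrow]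
    exact lowerHemicontinuous_image_prodMk lowerHemicontinuous_decompositions continuous_liftPair
  · simp only [mem_decompositions_liftArrow_iff]
    have continuous_proj : Continuous fun q : (Λ.PathArrow × A) × _ => projPair (c := c) q.2 :=
      continuous_projPair.comp continuous_snd
    have continuous_coord : Continuous fun q :
        (Λ.PathArrow × A) × ((Λ.skew c).Mor × (Λ.skew c).Mor) => q.1.2 := by fun_prop
    exact (isClosed_setOf_mem_decompositions.preimage
      ((continuous_fst.comp continuous_fst).prodMk continuous_proj)).inter
      (isClosed_eq (continuous_liftPair.comp (continuous_proj.prodMk continuous_coord))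
        continuous_snd)

theorem continuous_groupCoord :
    Continuous fun t : (Λ.skew c).PathArrow => (t.1.1.groupCoord : A) := by
  refine continuous_def.2 fun N hN => ?_
  have isOpen_coord : IsOpen {q : (Λ.skew c).Mor × (Λ.skew c).Mor | q.1.2 ∈ N} :=
    (hN.preimage (continuous_snd (X := Λ.Mor))).preimage continuous_fst
  convert lowerHemicontinuous_iff_isOpen_inter_nonempty.1
    (lowerHemicontinuous_decompositions (Λ := Λ.skew c)) _ isOpen_coord using 1
  ext t
  have coord_mem_iff {q} (hq : q ∈ decompositions t) : t.1.1.groupCoord ∈ N ↔ q.1.2 ∈ N :=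
    iff_of_eq (congrArg (· ∈ N) (groupCoord_eq_of_mem_decompositions hq))
  exact ⟨fun ht => (decompositions_nonempty t).imp fun _ hq => ⟨hq, (coord_mem_iff hq).1 ht⟩,
    fun ⟨_, hq, hqN⟩ => (coord_mem_iff hq).2 hqN⟩

theorem continuous_projArrow : Continuous (projArrow (c := c)) := by
  refine continuous_of_decompositions (continuous_pathArrow_degree (Λ := Λ.skew c)) ?_ ?_
  · simp only [decompositions_projArrow]
    refine lowerHemicontinuous_iff_isOpen_inter_nonempty.2 fun O hO => ?_
    simp only [Set.image_inter_nonempty_iff]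
    exact lowerHemicontinuous_iff_isOpen_inter_nonempty.1 lowerHemicontinuous_decompositions _
      (hO.preimage continuous_projPair)
  · simp only [mem_decompositions_projArrow_iff]
    exact isClosed_setOf_mem_decompositions.preimage (continuous_fst.prodMk
      (continuous_liftPair.comp
        (continuous_snd.prodMk (continuous_groupCoord.comp continuous_fst))))

variable (c) in
/-- Arrows of `G_{Λ ×_c A}` are arrows of `G_Λ` together with a group coordinate of the range. -/
noncomputable def liftArrowHomeomorph : Λ.PathArrow × A ≃ₜ (Λ.skew c).PathArrow where
  toFun p := liftArrow c p.1 p.2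
  invFun t := (projArrow t, t.1.1.groupCoord)
  left_inv p := Prod.ext rfl (Path.groupCoord_lift p.1.1.1 p.2)
  right_inv t := liftArrow_projArrow t
  continuous_toFun := continuous_liftArrow
  continuous_invFun := continuous_projArrow.prodMk continuous_groupCoord

variable (c) in
/-- The isomorphism `G_Λ(c̃) ≅ G_{Λ ×_c A}`. -/
noncomputable def skewPathGroupoidIso :
    TopGroupoid.Iso (Λ.pathGroupoid.skew (inducedCocycle c)) (Λ.skew c).pathGroupoid :=
  TopGroupoid.Iso.ofMor (G := Λ.pathGroupoid.skew (inducedCocycle c))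
    (H := (Λ.skew c).pathGroupoid) (Path.liftEquiv c) (liftArrowHomeomorph c)
    (fun _ => rfl) (fun _ => rfl)
    (fun ⟨x, a⟩ => Subtype.ext <| Prod.ext rfl <| Prod.ext rfl <| congrArg (x.lift c) <| by
      change a * (inducedCocycle c).toFun (Λ.pathGroupoid.one x) = a
      rw [(inducedCocycle c).map_one, mul_one])
    (fun ⟨t, a⟩ ⟨t', a'⟩ h => Subtype.ext <| Prod.ext rfl <| Prod.ext rfl <|
      congrArg (t'.1.2.2.lift c) <| by
        obtain rfl : a * (inducedCocycle c).toFun t = a' := congrArg Prod.snd h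
        have composable : Λ.pathGroupoid.s t = Λ.pathGroupoid.r t' := congrArg Prod.fst h
        change a * (inducedCocycle c).toFun (Λ.pathGroupoid.comp t t' composable)
          = a * (inducedCocycle c).toFun t * (inducedCocycle c).toFun t'
        rw [(inducedCocycle c).map_comp, mul_assoc])

end SkewArrows

section SkewBoundary

variable {A : Type w} [Group A] [TopologicalSpace A] [IsTopologicalGroup A]
  [LocallyCompactSpace A] [T2Space A] {c : ContFunctor Λ.toArrCat A}

theorem minExt_skew_nonempty_iff {f g : Λ.Mor} {a b : A} :
    ((Λ.skew c).minExt (f, a) (g, b)).Nonempty ↔ a = b ∧ (Λ.minExt f g).Nonempty := by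
  constructor
  · rintro ⟨⟨α, β⟩, hα, hβ, comp_eq, hd⟩
    exact ⟨congrArg Prod.snd comp_eq, ⟨(α.1, β.1), congrArg Prod.fst hα, congrArg Prod.fst hβ,
      congrArg Prod.fst comp_eq, hd⟩⟩
  · rintro ⟨rfl, ⟨α, β⟩, hα, hβ, comp_eq, hd⟩
    exact ⟨((α, a * c.toFun f), (β, a * c.toFun g)), Prod.ext hα rfl, Prod.ext hβ rfl,
      Prod.ext comp_eq rfl, hd⟩

variable (c) in
theorem prod_mem_CE {v : Λ.Obj} {a : A} {E : Set Λ.Mor} (hE : E ∈ Λ.CE v) {N : Set A}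
    (hN : IsCompact N) (hNa : N ∈ 𝓝 a) : (E ×ˢ N : Set (Λ.Mor × A)) ∈ (Λ.skew c).CE (v, a) := by
  obtain ⟨compact_E, range_E, -, exhaustive_E⟩ := hE
  have image_r : (Λ.skew c).r '' (E ×ˢ N : Set (Λ.Mor × A)) = (Λ.r '' E) ×ˢ N :=
    Set.prodMap_image_prod Λ.r id E N |>.trans (by rw [Set.image_id])
  refine ⟨compact_E.prod hN, image_r ▸ prod_mem_nhds range_E hNa,
    fun g hg => Set.mem_image_of_mem _ hg, ?_⟩
  rw [image_r]
  rintro ⟨f, b⟩ ⟨hf, hb⟩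
  obtain ⟨g, hg, minExt_ne⟩ := exhaustive_E f hf
  exact ⟨(g, b), ⟨hg, hb⟩, minExt_skew_nonempty_iff.2 ⟨rfl, minExt_ne⟩⟩

theorem slice_mem_CE {v : Λ.Obj} {a : A} {E : Set (Λ.skew c).Mor}
    (hE : E ∈ (Λ.skew c).CE (v, a)) : {f : Λ.Mor | ((f, a) : Λ.Mor × A) ∈ E} ∈ Λ.CE v := by
  obtain ⟨compact_E, range_E, -, exhaustive_E⟩ := hE
  have isClosedEmbedding_slice : IsClosedEmbedding fun f : Λ.Mor => (f, a) :=
    Function.LeftInverse.isClosedEmbedding (f := Prod.fst) (fun _ => rfl) continuous_fst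
      (Continuous.prodMk_left a)
  refine ⟨isClosedEmbedding_slice.isCompact_preimage compact_E, ?_,
    fun g hg => Set.mem_image_of_mem _ hg, ?_⟩
  · filter_upwards [(Continuous.prodMk_left a).continuousAt range_E]
    rintro _ ⟨⟨g, b⟩, hg, range_eq⟩
    obtain ⟨rfl, rfl⟩ := Prod.mk.inj range_eq
    exact ⟨g, hg, rfl⟩
  · rintro f ⟨g, hg, range_eq⟩
    obtain ⟨g', hg', minExt_ne⟩ := exhaustive_E (f, a) ⟨(g, a), hg, Prod.ext range_eq rfl⟩
    obtain ⟨rfl, minExt_ne'⟩ := minExt_skew_nonempty_iff.1 minExt_ne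
    exact ⟨g'.1, hg', minExt_ne'⟩

theorem isBoundary_lift_iff {x : Λ.Path} {a : A} :
    (x.lift c a).IsBoundary ↔ x.IsBoundary := by
  constructor
  · intro hx m hm E hE
    obtain ⟨N, hN, hNa⟩ := exists_compact_mem_nhds (a * c.toFun (x.map 0 m zero_le hm))
    obtain ⟨f, hf, hd, map_f⟩ := hx m hm _ (prod_mem_CE c hE hN hNa)
    exact ⟨f.1, hf.1, hd, congrArg Prod.fst map_f⟩
  · intro hx m hm E hE
    obtain ⟨f, hf, hd, map_f⟩ := hx m hm _ (slice_mem_CE hE)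
    exact ⟨_, hf, hd, Prod.ext map_f rfl⟩

variable (c) in
/-- The isomorphism `𝒢_Λ(c̃) ≅ 𝒢_{Λ ×_c A}`. -/
noncomputable def skewBoundaryGroupoidIso :
    TopGroupoid.Iso
      (Λ.boundaryGroupoid.skew (TopGroupoid.restrict (inducedCocycle c) Λ.boundary))
      (Λ.skew c).boundaryGroupoid :=
  (TopGroupoid.reductionSkewIso (inducedCocycle c) Λ.boundary).trans
    ((skewPathGroupoidIso c).reduction fun _ => isBoundary_lift_iff)

end SkewBoundary

end TopKGraph

end HRGraph

theorem mainTheorem6_general {k : ℕ} (Λ : HRGraph.TopKGraph.{u, v} k)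
    {A : Type w} [Group A] [TopologicalSpace A] [IsTopologicalGroup A]
    [LocallyCompactSpace A] [T2Space A]
    (c : HRGraph.ContFunctor Λ.toArrCat A) :
    Nonempty (HRGraph.TopGroupoid.Iso
      (Λ.pathGroupoid.skew (HRGraph.TopKGraph.inducedCocycle c))
      (Λ.skew c).pathGroupoid) ∧
    Nonempty (HRGraph.TopGroupoid.Iso
      (Λ.boundaryGroupoid.skew
        (HRGraph.TopGroupoid.restrict (HRGraph.TopKGraph.inducedCocycle c) Λ.boundary))
      (Λ.skew c).boundaryGroupoid) :=
  ⟨⟨HRGraph.TopKGraph.skewPathGroupoidIso c⟩, ⟨HRGraph.TopKGraph.skewBoundaryGroupoidIso c⟩⟩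

theorem mainTheorem6 {k : ℕ} (Λ : HRGraph.TopKGraph.{u, v} k)
    [SecondCountableTopology Λ.Obj] [SecondCountableTopology Λ.Mor]
    (hΛ : Λ.CompactlyAligned)
    {A : Type w} [Group A] [TopologicalSpace A] [IsTopologicalGroup A]
    [LocallyCompactSpace A] [T2Space A]
    (c : HRGraph.ContFunctor Λ.toArrCat A) :
    Nonempty (HRGraph.TopGroupoid.Iso
      (Λ.pathGroupoid.skew (HRGraph.TopKGraph.inducedCocycle c))
      (Λ.skew c).pathGroupoid) ∧
    Nonempty (HRGraph.TopGroupoid.Iso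
      (Λ.boundaryGroupoid.skew
        (HRGraph.TopGroupoid.restrict (HRGraph.TopKGraph.inducedCocycle c) Λ.boundary))
      (Λ.skew c).boundaryGroupoid) :=
  mainTheorem6_general Λ c
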